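/- Let $g \ge 2$ be an integer, let $l$ be a prime divisor of $2g-1$, let $p$ be a prime congruent to $1$ modulo $2g-1$, let $b$ be an integer that is not divisible by $l$ and is a primitive root modulo $p$, and let $c$ be an integer not divisible by $l$. (Such a $(l,p,b,c)$ is called a $g$-admissible quadruple.) Put $$f(x) = f_{g,l,p,b,c}(x) := x^{2g} - bx - \frac{pc}{l^l} \in \mathbb{Z}[1/l][x] \subset \mathbb{Q}[x].$$ Then: (i) $f(x)$ is irreducible over the field $\mathbb{Q}_l$ of $l$-adic numbers, and therefore over $\mathbb{Q}$. (ii) The reduction $f(x) \bmod p \in \mathbb{F}_p[x]$, taken via the unique ring homomorphism $\mathbb{Z}[1/l] \to \mathbb{F}_p$, is the product $x\,\bigl(x^{2g-1} - (b \bmod p)\bigr)$ of the linear factor $x$ and the polynomial $x^{2g-1} - (b \bmod p)$, which has degree $2g-1$ and is irreducible over $\mathbb{F}_p$. (iii) Let $R_f \subset \overline{\mathbb{Q}}$ be the set of roots of $f(x)$, which has exactly $2g$ elements, and let $\mathrm{Gal}(f)$ be the Galois group of $f(x)$ over $\mathbb{Q}$, viewed as a permutation group of $R_f$. Then $\mathrm{Gal}(f)$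 is transitive and contains a permutation that is a cycle of length $2g-1$; in particular, $\mathrm{Gal}(f)$ is doubly transitive on $R_f$. (iv) $f(x)$ has no real roots if and only if $$c < \frac{l^l \left(\frac{b}{2g}\right)^{1/(2g-1)} \left(\frac{b}{2g} - b\right)}{p},$$ where $\left(\frac{b}{2g}\right)^{1/(2g-1)}$ denotes the unique real $(2g-1)$-th root of $\frac{b}{2g}$ (which is negative if $b<0$). (v) If $\ell$ is a prime that divides $b$ and does not divide $2glp$, and if $c \equiv \ell \pmod{\ell^2}$, then the discriminant of the number field $\mathbb{Q}[x]/f(x)\mathbb{Q}[x]$ is divisible by $\ell$. (vi) If $\ell$ is a prime that divides $c$ and does not divide $(2g-1)pb$, then the discriminant of the number field $\mathbb{Q}[x]/f(x)\mathbb{Q}[x]$ is not divisible by $\ell$. -/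

import Mathlib

open Polynomial

/-- `(l, p, b, c)` is a `g`-admissible quadruple, for an integer `g ≥ 2`. -/
structure IsAdmissible (g l p : ℕ) (b c : ℤ) : Prop where
  two_le : 2 ≤ g
  prime_l : l.Prime
  l_dvd : l ∣ 2 * g - 1
  prime_p : p.Prime
  p_modEq : p ≡ 1 [MOD 2 * g - 1]
  l_not_dvd_b : ¬ (l : ℤ) ∣ b
  /-- `b` is a primitive root mod `p`: its class has exact multiplicative order `p - 1`. -/
  b_primitive : IsPrimitiveRoot (b : ZMod p) (p - 1)
  l_not_dvd_c : ¬ (l : ℤ) ∣ c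

/-- The polynomial `x^(2g) - b x - p c / l^l` over `ℚ`. -/
noncomputable def moriPoly (g l p : ℕ) (b c : ℤ) : ℚ[X] :=
  X ^ (2 * g) - C (b : ℚ) * X - C ((p : ℚ) * (c : ℚ) / (l : ℚ) ^ l)

/-- The subring `ℤ[1/l]` of `ℚ`. -/
def ZInv (l : ℕ) : Subalgebra ℤ ℚ := Algebra.adjoin ℤ {(l : ℚ)⁻¹}

/-- The element `1/l` of `ℤ[1/l]`. -/
def ZInv.inv (l : ℕ) : ZInv l := ⟨(l : ℚ)⁻¹, Algebra.subset_adjoin rfl⟩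

/-- The same polynomial `x^(2g) - b x - p c / l^l`, as a polynomial with coefficients
in `ℤ[1/l]`. -/
noncomputable def moriPolyZInv (g l p : ℕ) (b c : ℤ) : (ZInv l)[X] :=
  X ^ (2 * g) - C (b : ZInv l) * X - C ((p : ZInv l) * (c : ZInv l) * ZInv.inv l ^ l)

theorem moriPolyZInv_map (g l p : ℕ) (b c : ℤ) :
    (moriPolyZInv g l p b c).map (algebraMap (ZInv l) ℚ) = moriPoly g l p b c := by
  have h : algebraMap (ZInv l) ℚ (ZInv.inv l) = (l : ℚ)⁻¹ := rfl
  simp [moriPolyZInv, moriPoly, h, div_eq_mul_inv]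
  left
  rw [← C_pow, inv_pow]

/-- The real `n`-th root of a real number of any sign, for odd `n`. -/
noncomputable def oddRoot (n : ℕ) (x : ℝ) : ℝ := SignType.sign x * |x| ^ (1 / (n : ℝ))

theorem oddRoot_pow {n : ℕ} (hn : Odd n) (x : ℝ) : oddRoot n x ^ n = x := by
  have hn0 : n ≠ 0 := by rintro rfl; simp at hn
  have h : (|x| ^ (1 / (n : ℝ))) ^ n = |x| := by
    rw [one_div]; exact Real.rpow_inv_natCast_pow (abs_nonneg x) hn0
  rw [oddRoot, mul_pow, h]
  rcases lt_trichotomy x 0 with hx | rfl | hx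
  · simp [sign_neg hx, hn.neg_one_pow, abs_of_neg hx]
  · simp
  · simp [sign_pos hx, abs_of_pos hx]

/-- The Galois group over `ℚ` of a rational polynomial `f`, viewed as a group of permutations
of the set of roots of `f` in an algebraic closure of `ℚ`. -/
noncomputable def galPermGroup (f : ℚ[X]) :
    Subgroup (Equiv.Perm (f.rootSet (AlgebraicClosure ℚ))) :=
  haveI : Fact (f.map (algebraMap ℚ (AlgebraicClosure ℚ))).Splits :=
    ⟨IsAlgClosed.splits _⟩
  (Gal.galActionHom f (AlgebraicClosure ℚ)).range

/-! Each part reads the trinomial at one place. At `l` the coefficient `b` is a unit and the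
constant term has norm `l ^ l`, so the Newton polygon has a single slope: every root `x` satisfies
`‖x‖ ^ (2g) = l ^ l`. As `l ∣ 2g - 1` is prime to `2g`, such an `x` has degree at least `2g` over
`ℚ_[l]`, which proves (i) (`norm_root_pow`, `irreducible_map_padic`).

At `p` the constant term vanishes. Since `b` generates the units mod `p` and `2g - 1 ∣ p - 1`, `b`
is not a `q`-th power for any prime `q ∣ 2g - 1`, whence (ii). For (iii), the algebraic integers `l
α`, with `α` a root, stay distinct modulo a prime above `p`, and a Frobenius multiplies their
residues by a primitive `(2g - 1)`-th root of unity (`exists_frobenius_perm`). It fixes the root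
with residue `0` and cycles the others; together with transitivity this gives double transitivity.

Over `ℝ` the function is convex, so (iv) is the sign of its minimum. In (v) the equation of `l α` is
Eisenstein at `ℓ`, which forces ramification; in (vi) its reduction mod `ℓ` is separable, so its
derivative at `l α`, an element of the different, avoids every prime above `ℓ`. -/

/-- The coefficient form of evaluation of `moriPoly` in a `ℚ`-algebra. -/
theorem aeval_moriPoly {A : Type*} [CommRing A] [Algebra ℚ A] (g l p : ℕ) (b c : ℤ) (x : A) :
    aeval x (moriPoly g l p b c) =
      x ^ (2 * g) - (b : A) * x - algebraMap ℚ A ((p : ℚ) * c / (l : ℚ) ^ l) := by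
  simp [moriPoly]

theorem moriPoly_degree_aux {g l p : ℕ} {b c : ℤ} (hg : 2 ≤ g) :
    (C (b : ℚ) * X + C ((p : ℚ) * (c : ℚ) / (l : ℚ) ^ l)).degree < ((2 * g : ℕ) : WithBot ℕ) := by
  refine lt_of_le_of_lt degree_linear_le ?_
  exact_mod_cast (by omega : 1 < 2 * g)

theorem moriPoly_eq_X_pow_sub (g l p : ℕ) (b c : ℤ) :
    moriPoly g l p b c =
      X ^ (2 * g) - (C (b : ℚ) * X + C ((p : ℚ) * (c : ℚ) / (l : ℚ) ^ l)) := by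
  rw [moriPoly]; ring

theorem moriPoly_monic {g l p : ℕ} {b c : ℤ} (hg : 2 ≤ g) : (moriPoly g l p b c).Monic := by
  rw [moriPoly_eq_X_pow_sub]
  exact monic_X_pow_sub (moriPoly_degree_aux hg)

theorem moriPoly_natDegree {g l p : ℕ} {b c : ℤ} (hg : 2 ≤ g) :
    (moriPoly g l p b c).natDegree = 2 * g := by
  rw [moriPoly_eq_X_pow_sub]
  exact natDegree_eq_of_degree_eq_some 
    ((degree_sub_eq_left_of_degree_lt (by rw [degree_X_pow]; exact moriPoly_degree_aux hg)).trans
      (degree_X_pow _))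

/-! ### Irreducibility over the `l`-adic numbers. -/

namespace IsAdmissible

variable {g l p : ℕ} {b c : ℤ} (h : IsAdmissible g l p b c)
include h

theorem l_dvd_p_sub_one : l ∣ p - 1 :=
  h.l_dvd.trans ((Nat.modEq_iff_dvd' h.prime_p.one_lt.le).mp h.p_modEq.symm)

theorem degree_dvd_p_sub_one : 2 * g - 1 ∣ p - 1 :=
  (Nat.modEq_iff_dvd' h.prime_p.one_lt.le).mp h.p_modEq.symm

theorem l_lt_p : l < p := by
  have := Nat.le_of_dvd (by have := h.prime_p.two_le; omega) h.l_dvd_p_sub_one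
  have := h.prime_p.two_le
  omega

theorem l_ne_p : l ≠ p := h.l_lt_p.ne

theorem l_le : l ≤ 2 * g - 1 := Nat.le_of_dvd (by have := h.two_le; omega) h.l_dvd

theorem coprime_two_mul_g_l : Nat.Coprime (2 * g) l := by
  refine ((Nat.Prime.coprime_iff_not_dvd h.prime_l).mpr fun hd => ?_).symm
  have := (Nat.dvd_sub hd h.l_dvd)
  rw [show 2 * g - (2 * g - 1) = 1 by have := h.two_le; omega] at this
  exact h.prime_l.one_lt.ne' (Nat.dvd_one.mp this)

theorem norm_const [Fact l.Prime] :
    ‖(((p : ℚ) * (c : ℚ) / (l : ℚ) ^ l : ℚ) : ℚ_[l])‖ = (l : ℝ) ^ l := by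
  have hp : ‖(p : ℚ_[l])‖ = 1 :=
    Padic.norm_natCast_eq_one_iff.mpr ((Nat.coprime_primes h.prime_l h.prime_p).mpr h.l_ne_p)
  have hc : ‖(c : ℚ_[l])‖ = 1 := by
    refine le_antisymm (Padic.norm_int_le_one c) (not_lt.mp fun hlt => ?_)
    exact h.l_not_dvd_c (Padic.norm_intCast_lt_one_iff.mp hlt)
  push_cast
  rw [norm_div, norm_mul, hp, hc, norm_pow, Padic.norm_p]
  simp

/-- A root of `moriPoly` in the algebraic closure of `ℚ_[l]` has the norm predicted by the
single slope of the Newton polygon. -/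
theorem norm_root_pow [Fact l.Prime] (x : PadicAlgCl l)
    (hx : x ^ (2 * g) - (b : PadicAlgCl l) * x -
      algebraMap ℚ_[l] (PadicAlgCl l) (((p : ℚ) * (c : ℚ) / (l : ℚ) ^ l : ℚ) : ℚ_[l]) = 0) :
    ‖x‖ ^ (2 * g) = (l : ℝ) ^ l := by
  have hb : ‖(b : PadicAlgCl l)‖ = 1 := by
    have h1 : ‖(b : ℚ_[l])‖ = 1 := by
      refine le_antisymm (Padic.norm_int_le_one b) (not_lt.mp fun hlt => ?_)
      exact h.l_not_dvd_b (Padic.norm_intCast_lt_one_iff.mp hlt)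
    rw [← h1, ← PadicAlgCl.norm_extends, map_intCast]
  have hconst : ‖x ^ (2 * g) - (b : PadicAlgCl l) * x‖ = (l : ℝ) ^ l := by
    rw [sub_eq_zero.mp hx, PadicAlgCl.norm_extends, h.norm_const]
  have hl1 : (1 : ℝ) < (l : ℝ) ^ l :=
    one_lt_pow₀ (by exact_mod_cast h.prime_l.one_lt) h.prime_l.ne_zero
  have hbx : ‖(b : PadicAlgCl l) * x‖ = ‖x‖ := by rw [norm_mul, hb, one_mul]
  have hg := h.two_le
  have h1 : 1 < ‖x‖ := by
    by_contra! hle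
    have := IsUltrametricDist.norm_add_le_max (x ^ (2 * g)) (-((b : PadicAlgCl l) * x))
    rw [← sub_eq_add_neg, hconst, norm_neg, hbx, norm_pow] at this
    have h2 : ‖x‖ ^ (2 * g) ≤ 1 := pow_le_one₀ (norm_nonneg _) hle
    exact absurd (this.trans (max_le h2 hle)) (not_le.mpr hl1)
  have hlt : ‖(b : PadicAlgCl l) * x‖ < ‖x ^ (2 * g)‖ := by
    rw [hbx, norm_pow]
    calc ‖x‖ = ‖x‖ ^ 1 := (pow_one _).symm
      _ < ‖x‖ ^ (2 * g) := pow_lt_pow_right₀ h1 (by omega)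
  rw [← norm_pow, ← hconst, sub_eq_add_neg]
  have := IsUltrametricDist.norm_add_eq_max_of_norm_ne_norm
    (x := x ^ (2 * g)) (y := -((b : PadicAlgCl l) * x)) (by rw [norm_neg]; exact hlt.ne')
  rw [this, norm_neg, max_eq_left hlt.le]

/-- If a root has degree `d` over `ℚ_[l]`, the `d`-th power of its norm is the norm of the constant
coefficient of its minimal polynomial, an integral power of `l`. Compared with `norm_root_pow` this
gives `2g ∣ l * d`, so `2g ∣ d`, and the minimal polynomial is all of `f`. -/
theorem irreducible_map_padic [Fact l.Prime] :
    Irreducible ((moriPoly g l p b c).map (algebraMap ℚ ℚ_[l])) := by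
  set f := (moriPoly g l p b c).map (algebraMap ℚ ℚ_[l]) with hf
  have hg := h.two_le
  have hmon : f.Monic := (moriPoly_monic hg).map _
  have hdeg : f.natDegree = 2 * g := by
    rw [hf, (moriPoly_monic hg).natDegree_map, moriPoly_natDegree hg]
  obtain ⟨x, hx⟩ := IsAlgClosed.exists_aeval_eq_zero (PadicAlgCl l) f
    (by rw [degree_eq_natDegree hmon.ne_zero, hdeg]; exact_mod_cast (by omega : 2 * g ≠ 0))
  have hint : IsIntegral ℚ_[l] x := ⟨f, hmon, hx⟩
  have hdvd : minpoly ℚ_[l] x ∣ f := minpoly.dvd _ _ hx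
  set d := (minpoly ℚ_[l] x).natDegree with hd
  have hd0 : 0 < d := minpoly.natDegree_pos hint
  have hnorm := h.norm_root_pow x (by simpa [hf, moriPoly] using hx)
  have hsp := spectralNorm.spectralNorm_eq_norm_coeff_zero_rpow ℚ_[l] (PadicAlgCl l) x
  rw [PadicAlgCl.spectralNorm_eq] at hsp
  have hxd : ‖x‖ ^ d = ‖(minpoly ℚ_[l] x).coeff 0‖ := by
    rw [hsp, one_div, ← hd, Real.rpow_inv_natCast_pow (norm_nonneg _) hd0.ne']
  have hne : (minpoly ℚ_[l] x).coeff 0 ≠ 0 := by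
    intro h0
    rw [h0, norm_zero] at hxd
    rw [eq_zero_of_pow_eq_zero hxd, zero_pow (by omega)] at hnorm
    have : (0 : ℝ) < (l : ℝ) ^ l := pow_pos (by exact_mod_cast h.prime_l.pos) _
    exact this.ne hnorm
  rw [Padic.norm_eq_zpow_neg_valuation hne] at hxd
  set k := -((minpoly ℚ_[l] x).coeff 0).valuation
  have hkey : (l : ℝ) ^ ((l * d : ℕ) : ℤ) = (l : ℝ) ^ (k * (2 * g : ℕ)) := by
    rw [zpow_natCast, pow_mul, ← hnorm, ← pow_mul, mul_comm, pow_mul, hxd, zpow_mul, zpow_natCast]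
  have hexp := zpow_right_injective₀ (by exact_mod_cast h.prime_l.pos)
    (by exact_mod_cast h.prime_l.one_lt.ne') hkey
  have hdiv : 2 * g ∣ l * d := by
    rw [← Int.natCast_dvd_natCast, hexp]
    exact Dvd.intro_left k rfl
  have hdd : 2 * g ≤ d := Nat.le_of_dvd hd0 (h.coprime_two_mul_g_l.dvd_of_dvd_mul_left hdiv)
  rw [eq_of_monic_of_dvd_of_natDegree_le (minpoly.monic hint) hmon hdvd (by omega)]
  exact minpoly.irreducible hint

theorem irreducible_moriPoly : Irreducible (moriPoly g l p b c) :=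
  haveI : Fact l.Prime := ⟨h.prime_l⟩
  (moriPoly_monic h.two_le).irreducible_of_irreducible_map _ _ h.irreducible_map_padic

end IsAdmissible

/-! ### Reduction of `ℤ[1/l]` modulo `p`. -/

/-- The generator `1/l` can only go to the inverse of the image of `l`, which is nonzero because `l`
is a unit of `ℤ[1/l]`. -/
theorem ZInv.ringHom_ext {l : ℕ} {F : Type*} [Field F] {φ ψ : ZInv l →+* F}
    (hl : (l : ℚ) ≠ 0) : φ = ψ := by
  have hmul : (l : ZInv l) * ZInv.inv l = 1 := Subtype.ext (mul_inv_cancel₀ hl)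
  have hinv : ∀ χ : ZInv l →+* F, χ (ZInv.inv l) = (l : F)⁻¹ := fun χ => by
    have h1 := congrArg χ hmul
    rw [map_mul, map_natCast, map_one] at h1
    exact eq_inv_of_mul_eq_one_right h1
  have halg : φ.toIntAlgHom = ψ.toIntAlgHom := by
    refine AlgHom.adjoin_ext fun x hx => ?_
    obtain rfl := Set.mem_singleton_iff.mp hx
    exact (hinv φ).trans (hinv ψ).symm
  exact RingHom.ext fun x => DFunLike.congr_fun halg x

/-- The reduction map `ℤ[1/l] → ZMod p`, for a prime `p` not dividing `l`. -/
theorem ZInv.exists_ringHom {l p : ℕ} [Fact p.Prime] (hl : Nat.Coprime p l) :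
    Nonempty (ZInv l →+* ZMod p) := by
  -- `1/l` has `p`-adic norm 1, so `ℤ[1/l]` embeds in the `p`-adic integers; the reduction is their
  -- residue map.
  have hmem : ∀ x : ZInv l, ((x : ℚ) : ℚ_[p]) ∈ PadicInt.subring p := by
    rintro ⟨x, hx⟩
    have hle : ZInv l ≤ subalgebraOfSubring ((PadicInt.subring p).comap (algebraMap ℚ ℚ_[p])) := by
      refine Algebra.adjoin_le ?_
      rintro _ rfl
      change ‖(((l : ℚ)⁻¹ : ℚ) : ℚ_[p])‖ ≤ 1
      push_cast
      rw [norm_inv, Padic.norm_natCast_eq_one_iff.mpr hl, inv_one]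
    exact hle hx
  exact ⟨(PadicInt.toZMod (p := p)).comp
    (((algebraMap ℚ ℚ_[p]).comp (algebraMap (ZInv l) ℚ)).codRestrict (PadicInt.subring p) hmem)⟩

/-! ### Real roots. -/

/-- The tangent line inequality for an even power. -/
theorem even_pow_tangent_le {N : ℕ} (hN : Even N) (hN0 : N ≠ 0) (x t : ℝ) :
    t ^ N + N * t ^ (N - 1) * (x - t) ≤ x ^ N := by
  obtain ⟨n, rfl⟩ := Nat.exists_eq_succ_of_ne_zero hN0
  simp only [Nat.succ_eq_add_one, Nat.add_sub_cancel] at *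
  rcases eq_or_ne t 0 with rfl | ht
  · have hn : n ≠ 0 := by rintro rfl; simp at hN
    simpa [hn] using hN.pow_nonneg x
  have htp : 0 < |t| := abs_pos.mpr ht
  -- Bernoulli's inequality for `|x| / |t|`, to be scaled by `|t| ^ N`. As `N` is even, absolute
  -- values survive only in the linear term, where they can be dropped by `h4`.
  have h1 := one_add_mul_sub_le_pow (a := |x| / |t|)
    (by linarith [div_nonneg (abs_nonneg x) htp.le]) (n + 1)
  have h2 := mul_le_mul_of_nonneg_right h1 (pow_nonneg htp.le (n + 1))
  rw [← mul_pow, div_mul_cancel₀ _ htp.ne', hN.pow_abs, hN.pow_abs] at h2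
  have h3 : (|x| / |t| - 1) * t ^ (n + 1) = |t| ^ n * |x| - t ^ (n + 1) := by
    rw [← hN.pow_abs t, pow_succ]; field_simp
  have h4 : t ^ n * x ≤ |t| ^ n * |x| := by
    rw [← abs_pow, ← abs_mul]; exact le_abs_self _
  have h5 : (0 : ℝ) ≤ ((n + 1 : ℕ) : ℝ) := Nat.cast_nonneg _
  have h6 := mul_le_mul_of_nonneg_left h4 h5
  have h7 : (1 + ((n + 1 : ℕ) : ℝ) * (|x| / |t| - 1)) * t ^ (n + 1) =
      t ^ (n + 1) + ((n + 1 : ℕ) : ℝ) * ((|x| / |t| - 1) * t ^ (n + 1)) := by ring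
  rw [h7, h3] at h2
  have h8 : ((n + 1 : ℕ) : ℝ) * t ^ n * (x - t) =
      ((n + 1 : ℕ) : ℝ) * (t ^ n * x) - ((n + 1 : ℕ) : ℝ) * t ^ (n + 1) := by ring
  rw [h8]
  linarith

/-- The minimum of `x ^ (2 * g) - b * x - d` decides whether it has a real root. -/
theorem exists_root_even_trinomial_iff {g : ℕ} (hg : 1 ≤ g) {b d t : ℝ}
    (ht : t ^ (2 * g - 1) = b / (2 * g)) :
    (∃ x : ℝ, x ^ (2 * g) - b * x - d = 0) ↔ t * (b / (2 * g) - b) ≤ d := by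
  have hg0 : (2 * g : ℝ) ≠ 0 := by positivity
  have hval : t ^ (2 * g) - b * t = t * (b / (2 * g) - b) := by
    rw [← ht, mul_sub, mul_pow_sub_one (by omega)]; ring
  constructor
  · rintro ⟨x, hx⟩
    -- `t` is the critical point: the tangent to `x ^ (2g)` there has slope `b`, so `x ^ (2g) - b *
    -- x` is minimal at `t`.
    have h1 := even_pow_tangent_le (even_two_mul g) (by omega) x t
    rw [ht] at h1
    push_cast at h1
    rw [mul_div_cancel₀ _ hg0] at h1
    linarith
  · intro hd
    have hcont : Continuous fun x : ℝ => x ^ (2 * g) - b * x - d := by fun_prop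
    -- With `M = 1 + |b| + |d| ≥ 1`, one has `M ^ (2g) ≥ M * M ≥ b * M + d`, so the value at `M` is
    -- nonnegative.
    refine mem_range_of_exists_le_of_exists_ge hcont ⟨t, by linarith⟩ ⟨1 + |b| + |d|, ?_⟩
    have hM : 1 ≤ 1 + |b| + |d| := by linarith [abs_nonneg b, abs_nonneg d]
    have h2 : (1 + |b| + |d|) ^ 2 ≤ (1 + |b| + |d|) ^ (2 * g) :=
      pow_le_pow_right₀ hM (by omega)
    have h3 : b * (1 + |b| + |d|) ≤ |b| * (1 + |b| + |d|) :=
      mul_le_mul_of_nonneg_right (le_abs_self b) (by linarith)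
    nlinarith [le_abs_self d, abs_nonneg b, abs_nonneg d,
      mul_nonneg (abs_nonneg b) (abs_nonneg d)]

/-! ### The reduction modulo `p`, and the real root criterion for `moriPoly`. -/

namespace IsAdmissible

variable {g l p : ℕ} {b c : ℤ} (h : IsAdmissible g l p b c)
include h

theorem b_ne_zero [Fact p.Prime] : (b : ZMod p) ≠ 0 := by
  intro h0
  have h1 := h.b_primitive.pow_eq_one
  rw [h0, zero_pow] at h1
  · exact zero_ne_one h1
  · have := h.l_lt_p
    have := h.prime_l.two_le
    omega

/-- For odd exponents it suffices that `b` is not a `q`-th power for any prime `q ∣ 2g - 1`. If it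
were, `q ∣ p - 1` would make the order of `b` divide `(p - 1) / q`. -/
theorem irreducible_X_pow_sub_b [Fact p.Prime] :
    Irreducible (X ^ (2 * g - 1) - C (b : ZMod p)) := by
  have hg := h.two_le
  have hp := h.prime_p.two_le
  refine X_pow_sub_C_irreducible_of_odd ⟨g - 1, by omega⟩ fun q hq hqn y hy => ?_
  have hqp : q ∣ p - 1 := hqn.trans h.degree_dvd_p_sub_one
  have hy0 : y ≠ 0 := by
    rintro rfl
    exact h.b_ne_zero (by rw [← hy, zero_pow hq.ne_zero])
  have h1 : (b : ZMod p) ^ ((p - 1) / q) = 1 := by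
    rw [← hy, ← pow_mul, Nat.mul_div_cancel' hqp, ZMod.pow_card_sub_one_eq_one hy0]
  have h2 := Nat.le_of_dvd
    (Nat.div_pos (Nat.le_of_dvd (by omega) hqp) hq.pos) (h.b_primitive.dvd_of_pow_eq_one _ h1)
  exact absurd h2 (not_le.mpr (Nat.div_lt_self (by omega) hq.one_lt))

theorem exists_reduction [Fact p.Prime] :
    ∃ φ : ZInv l →+* ZMod p, (∀ ψ : ZInv l →+* ZMod p, ψ = φ) ∧
      (moriPolyZInv g l p b c).map φ = X * (X ^ (2 * g - 1) - C (b : ZMod p)) := by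
  obtain ⟨φ⟩ := ZInv.exists_ringHom
    ((Nat.coprime_primes h.prime_p h.prime_l).mpr h.l_ne_p.symm)
  refine ⟨φ, fun ψ => ZInv.ringHom_ext (by exact_mod_cast h.prime_l.ne_zero), ?_⟩
  have hg := h.two_le
  have hp : φ (p : ZInv l) = 0 := by rw [map_natCast, CharP.cast_eq_zero]
  simp only [moriPolyZInv, Polynomial.map_sub, Polynomial.map_pow, Polynomial.map_X,
    Polynomial.map_mul, Polynomial.map_C, map_mul φ, hp, map_intCast φ, zero_mul, C_0, sub_zero,
    mul_sub, mul_pow_sub_one (show 2 * g ≠ 0 by omega)]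
  ring

theorem no_real_root_iff :
    (¬ ∃ x : ℝ, aeval x (moriPoly g l p b c) = 0) ↔
      (c : ℝ) < (l : ℝ) ^ l * oddRoot (2 * g - 1) ((b : ℝ) / (2 * g)) *
        ((b : ℝ) / (2 * g) - b) / p := by
  have hg := h.two_le
  have hroot := oddRoot_pow (n := 2 * g - 1) ⟨g - 1, by omega⟩ ((b : ℝ) / (2 * g))
  have hl : (0 : ℝ) < (l : ℝ) ^ l := pow_pos (by exact_mod_cast h.prime_l.pos) _
  have hp : (0 : ℝ) < p := by exact_mod_cast h.prime_p.pos
  simp only [aeval_moriPoly, eq_ratCast]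
  push_cast
  rw [exists_root_even_trinomial_iff (by omega) hroot, not_le, lt_div_iff₀ hp, div_lt_iff₀ hl]
  constructor <;> intro hlt <;> linarith

end IsAdmissible

/-! ### The integral model `l α`, Frobenius, and the Galois group. -/

/-- Clearing denominators in the equation of a root of `moriPoly`. -/
theorem scaled_root_equation {A : Type*} [Field A] [Algebra ℚ A] {g l p : ℕ} {b c : ℤ}
    (hl : l ≠ 0) (hlg : l ≤ 2 * g) (hg : g ≠ 0) {x : A}
    (hx : aeval x (moriPoly g l p b c) = 0) :
    ((l : A) * x) ^ (2 * g) = ((b * l ^ (2 * g - 1) : ℤ) : A) * ((l : A) * x) +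
      ((p * c * l ^ (2 * g - l) : ℤ) : A) := by
  have : CharZero A := algebraRat.charZero A
  have hlA : (l : A) ≠ 0 := by exact_mod_cast hl
  rw [aeval_moriPoly, sub_sub, sub_eq_zero] at hx
  have hpow : (l : A) ^ (2 * g) = (l : A) ^ (2 * g - l) * (l : A) ^ l := by
    rw [← pow_add, Nat.sub_add_cancel hlg]
  have hpow' : (l : A) ^ (2 * g) = (l : A) ^ (2 * g - 1) * l := by
    rw [pow_sub_one_mul (by omega)]
  have hconst : (l : A) ^ (2 * g) * algebraMap ℚ A ((p : ℚ) * c / (l : ℚ) ^ l) =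
      p * c * (l : A) ^ (2 * g - l) := by
    rw [hpow, map_div₀, map_mul, map_pow, map_natCast, map_natCast, map_intCast]
    field_simp
  push_cast
  rw [mul_pow, hx, mul_add, hconst, hpow']
  ring

/-- A trinomial `X ^ N - a X` has no multiple roots if `a` and `N - 1` do not vanish. -/
theorem not_multiple_root {k : Type*} [Field k] {N : ℕ} (hN : 2 ≤ N) {a u : k} (ha : a ≠ 0)
    (hN1 : ((N - 1 : ℕ) : k) ≠ 0) (hu : u ^ N = a * u) : (N : k) * u ^ (N - 1) ≠ a := by
  intro hd
  rcases eq_or_ne u 0 with rfl | hu0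
  · rw [zero_pow (by omega), mul_zero] at hd
    exact ha hd.symm
  · have h1 : u ^ (N - 1) = a := by
      refine mul_right_cancel₀ hu0 ?_
      rw [← hu, pow_sub_one_mul (by omega)]
    rw [h1] at hd
    have h2 : ((N - 1 : ℕ) : k) * a = 0 := by
      rw [Nat.cast_sub (by omega), Nat.cast_one, sub_mul, hd, one_mul, sub_self]
    exact (mul_ne_zero hN1 ha) h2

/-- Distinct roots of `X ^ N - a X - d` have distinct reductions if the reduction `X ^ N - a X`
is separable. -/
theorem reduction_ne_of_ne {S k : Type*} [CommRing S] [IsDomain S] [Field k] (π : S →+* k) {N : ℕ}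
    (hN : 2 ≤ N) {a d x y : S} (hd : π d = 0) (ha : π a ≠ 0) (hN1 : ((N - 1 : ℕ) : k) ≠ 0)
    (hx : x ^ N = a * x + d) (hy : y ^ N = a * y + d) (hxy : x ≠ y) : π x ≠ π y := by
  intro hπ
  -- Subtracting the two equations and cancelling `x - y` leaves this divided difference. If the
  -- residues agree it reduces to the derivative of `X ^ N`, making the common residue a multiple
  -- root of `X ^ N - a X`.
  have h1 : (∑ i ∈ Finset.range N, x ^ i * y ^ (N - 1 - i)) = a := by
    refine mul_right_cancel₀ (sub_ne_zero.mpr hxy) ?_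
    rw [geom_sum₂_mul, hx, hy]
    ring
  have h2 := congrArg π h1
  rw [RingHom.map_geom_sum₂, hπ, geom_sum₂_self] at h2
  refine not_multiple_root hN ha hN1 ?_ h2
  rw [← map_pow, hy, map_add, hd, add_zero, map_mul]

/-- A permutation acting on reductions of `n + 1` points, which are the roots of `X (X ^ n - B)`,
as multiplication by a primitive `n`-th root of unity, fixes one point and permutes the others
cyclically. -/
theorem exists_fixed_point_of_mul_primitiveRoot {R k : Type*} [Finite R] [Field k]
    {n : ℕ} (hn : 2 ≤ n) (hcard : Nat.card R = n + 1) {σ : Equiv.Perm R} {r : R → k}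
    (hr : Function.Injective r) {B ζ : k} (hB : B ≠ 0) (hζ : IsPrimitiveRoot ζ n)
    (hroot : ∀ x, r x ≠ 0 → r x ^ n = B) (hσ : ∀ x, r (σ x) = ζ * r x) :
    ∃ x₀, σ x₀ = x₀ ∧ (∀ x, x ≠ x₀ → σ x ≠ x) ∧
      ∀ x y, x ≠ x₀ → y ≠ x₀ → ∃ i : ℕ, (σ ^ i) x = y := by
  classical
  obtain ⟨x₀, hx₀⟩ : ∃ x₀, r x₀ = 0 := by
    -- Otherwise `n + 1` distinct residues would all be roots of `X ^ n - B`.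
    by_contra! hne
    have hle : Nat.card R ≤ ((nthRoots n B).toFinset).card := by
      have := Fintype.ofFinite R
      rw [Nat.card_eq_fintype_card, ← Finset.card_univ]
      refine Finset.card_le_card_of_injOn r (fun x _ => ?_) hr.injOn
      rw [Finset.mem_coe, Multiset.mem_toFinset, mem_nthRoots (by omega)]
      exact hroot x (hne x)
    have := (Multiset.toFinset_card_le (nthRoots n B)).trans (card_nthRoots n B)
    omega
  have hne : ∀ x, x ≠ x₀ → r x ≠ 0 := fun x hx h0 => hx (hr (h0.trans hx₀.symm))
  have hpow : ∀ (i : ℕ) x, r ((σ ^ i) x) = ζ ^ i * r x := by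
    intro i x
    induction i with
    | zero => simp
    | succ i ih => rw [pow_succ', Equiv.Perm.mul_apply, hσ, ih]; ring
  refine ⟨x₀, hr (by rw [hσ, hx₀, mul_zero]), fun x hx hfix => ?_, fun x y hx hy => ?_⟩
  · have h1 := hσ x
    rw [hfix] at h1
    exact hζ.ne_one (by omega) (mul_right_cancel₀ (hne x hx) (by rw [one_mul]; exact h1.symm))
  · have : NeZero n := ⟨by omega⟩
    have h1 : (r y / r x) ^ n = 1 := by
      rw [div_pow, hroot x (hne x hx), hroot y (hne y hy), div_self hB]
    obtain ⟨i, -, hi⟩ := hζ.eq_pow_of_pow_eq_one h1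
    refine ⟨i, hr ?_⟩
    rw [hpow, hi, div_mul_cancel₀ _ (hne x hx)]

theorem isCycle_and_ncard_of_fixed_point {R : Type*} [Finite R] {n : ℕ} (hn : 2 ≤ n)
    (hcard : Nat.card R = n + 1) {σ : Equiv.Perm R} {x₀ : R} (hfix : σ x₀ = x₀)
    (hmove : ∀ x, x ≠ x₀ → σ x ≠ x)
    (htrans : ∀ x y, x ≠ x₀ → y ≠ x₀ → ∃ i : ℕ, (σ ^ i) x = y) :
    σ.IsCycle ∧ {x | σ x ≠ x}.ncard = n := by
  have hset : {x | σ x ≠ x} = {x₀}ᶜ := by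
    ext x
    simp only [Set.mem_ofPred_eq, Set.mem_compl_iff, Set.mem_singleton_iff]
    exact ⟨fun hx h0 => hx (h0 ▸ hfix), hmove x⟩
  have : Nontrivial R := Finite.one_lt_card_iff_nontrivial.mp (by omega)
  obtain ⟨y, hy⟩ := exists_ne x₀
  refine ⟨⟨y, hmove y hy, fun z hz => ?_⟩, ?_⟩
  · obtain ⟨i, hi⟩ := htrans y z hy fun h0 => hz (h0 ▸ hfix)
    exact ⟨i, by rw [zpow_natCast, hi]⟩
  · rw [hset, Set.ncard_compl, Set.ncard_singleton, hcard, Nat.add_sub_cancel]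

/-- A transitive group of permutations containing an element that fixes a point and permutes the
others transitively is doubly transitive. -/
theorem isMultiplyPretransitive_two_of_fixed_point {R : Type*} {G : Subgroup (Equiv.Perm R)}
    [MulAction.IsPretransitive G R] {σ : Equiv.Perm R} (hσ : σ ∈ G) {x₀ : R}
    (hfix : σ x₀ = x₀)
    (htrans : ∀ x y, x ≠ x₀ → y ≠ x₀ → ∃ i : ℕ, (σ ^ i) x = y) :
    MulAction.IsMultiplyPretransitive G R 2 := by
  rw [MulAction.is_two_pretransitive_iff]
  intro a b c d hab hcd
  obtain ⟨u, hu⟩ := MulAction.exists_smul_eq G a x₀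
  obtain ⟨v, hv⟩ := MulAction.exists_smul_eq G c x₀
  have hub : u • b ≠ x₀ := fun h0 => hab (smul_left_cancel u (hu.trans h0.symm))
  have hvd : v • d ≠ x₀ := fun h0 => hcd (smul_left_cancel v (hv.trans h0.symm))
  obtain ⟨i, hi⟩ := htrans _ _ hub hvd
  -- Move the first point to `x₀`, correct the second by a power of `σ`, which keeps `x₀` fixed, and
  -- move back.
  refine ⟨v⁻¹ * (⟨σ, hσ⟩ ^ i * u), ?_, ?_⟩
  · rw [mul_smul, mul_smul, hu, inv_smul_eq_iff, hv]
    exact Equiv.Perm.pow_apply_eq_self_of_apply_eq_self hfix i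
  · rw [mul_smul, mul_smul, inv_smul_eq_iff]
    exact hi

/-- Existence of a Frobenius element at some prime above `p`. -/
theorem exists_frobenius (E : Type*) [Field E] [inst : Algebra ℚ E]
    [FiniteDimensional ℚ E] [IsGalois ℚ E] (p : ℕ) [Fact p.Prime] :
    ∃ (Q : Ideal (NumberField.RingOfIntegers E)) (_ : Q.IsMaximal) (σ : E ≃ₐ[ℚ] E),
      (p : NumberField.RingOfIntegers E) ∈ Q ∧
      ∀ x y : NumberField.RingOfIntegers E, (y : E) = σ x →
        Ideal.Quotient.mk Q y = Ideal.Quotient.mk Q x ^ p := by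
  have : CharZero E := algebraRat.charZero E
  -- A `ℚ`-algebra structure is unique, so the given one, in the application that of a splitting
  -- field, may be taken to be the canonical one.
  obtain rfl : inst = DivisionRing.toRatAlgebra := Subsingleton.elim _ _
  have : NumberField E := { }
  have hp : p.Prime := Fact.out
  have hmax : (Ideal.span {(p : ℤ)}).IsMaximal :=
    PrincipalIdealRing.isMaximal_of_irreducible (Nat.prime_iff_prime_int.mp hp).irreducible
  obtain ⟨Q, hQ, hQp⟩ := Ideal.exists_ideal_over_maximal_of_isIntegral
    (S := NumberField.RingOfIntegers E) (Ideal.span {(p : ℤ)}) (by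
      rw [(RingHom.injective_iff_ker_eq_bot _).mp
        (FaithfulSMul.algebraMap_injective ℤ (NumberField.RingOfIntegers E))]
      exact bot_le)
  have hmem : (p : NumberField.RingOfIntegers E) ∈ Q := by
    have : (p : ℤ) ∈ Q.comap (algebraMap ℤ (NumberField.RingOfIntegers E)) := by
      rw [hQp]; exact Ideal.mem_span_singleton_self _
    simpa using this
  have hbot : Q ≠ ⊥ := by
    rintro rfl
    exact hp.ne_zero (by exact_mod_cast (Ideal.mem_bot.mp hmem))
  have : Finite (NumberField.RingOfIntegers E ⧸ Q) := Ideal.finiteQuotientOfFreeOfNeBot Q hbot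
  obtain ⟨σ, hσ⟩ := IsArithFrobAt.exists_of_isInvariant ℤ (E ≃ₐ[ℚ] E) Q
  refine ⟨Q, hQ, σ, hmem, fun x y hxy => ?_⟩
  have hcard : Nat.card (ℤ ⧸ Q.under ℤ) = p := by
    rw [Ideal.under, hQp, Nat.card_congr (Int.quotientSpanNatEquivZMod p).toEquiv, Nat.card_zmod]
  have h1 := AlgHom.IsArithFrobAt.mk_apply hσ x
  rw [hcard] at h1
  have hy : y = MulSemiringAction.toAlgHom ℤ (NumberField.RingOfIntegers E) σ x := by
    apply NumberField.RingOfIntegers.ext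
    rw [hxy]
    rfl
  rw [hy]
  exact h1

namespace IsAdmissible

variable {g l p : ℕ} {b c : ℤ} (h : IsAdmissible g l p b c)
include h

theorem card_rootSet :
    Nat.card ((moriPoly g l p b c).rootSet (AlgebraicClosure ℚ)) = 2 * g := by
  rw [Nat.card_eq_fintype_card, card_rootSet_eq_natDegree h.irreducible_moriPoly.separable
    (IsAlgClosed.splits _), moriPoly_natDegree h.two_le]

/-- Multiplying the equation by `l ^ (2g)` absorbs the denominator `l ^ l`, because `l ≤ 2g - 1`. -/
theorem isIntegral_mul_root {A : Type*} [Field A] [Algebra ℚ A] {x : A}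
    (hx : aeval x (moriPoly g l p b c) = 0) : IsIntegral ℤ ((l : A) * x) := by
  have hg := h.two_le
  have hl := h.l_le
  refine ⟨X ^ (2 * g) - (C (b * l ^ (2 * g - 1)) * X + C (p * c * l ^ (2 * g - l))), ?_, ?_⟩
  · refine monic_X_pow_sub (lt_of_le_of_lt degree_linear_le ?_)
    exact_mod_cast (by omega : 1 < 2 * g)
  · have h1 := scaled_root_equation h.prime_l.ne_zero (by omega) (by omega) hx
    simp only [eval₂_sub, eval₂_X_pow, eval₂_add, eval₂_mul, eval₂_C, eval₂_X, h1]
    simp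

theorem galPermGroup_isPretransitive :
    MulAction.IsPretransitive (galPermGroup (moriPoly g l p b c))
      ((moriPoly g l p b c).rootSet (AlgebraicClosure ℚ)) := by
  have : Fact ((moriPoly g l p b c).map (algebraMap ℚ (AlgebraicClosure ℚ))).Splits :=
    ⟨IsAlgClosed.splits _⟩
  have := Gal.galAction_isPretransitive _ (AlgebraicClosure ℚ) h.irreducible_moriPoly
  refine ⟨fun x y => ?_⟩
  obtain ⟨τ, hτ⟩ := MulAction.exists_smul_eq (moriPoly g l p b c).Gal x y
  exact ⟨⟨_, τ, rfl⟩, hτ⟩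

/-- The Frobenius at a prime above `p`, as a permutation of the roots. -/
theorem exists_frobenius_perm {E : Type*} [Field E] [Algebra ℚ E] [FiniteDimensional ℚ E]
    [IsGalois ℚ E] :
    ∃ σ : E ≃ₐ[ℚ] E, ∀ {R : Type} (_ : Nat.card R = 2 * g)
      (e : R ≃ (moriPoly g l p b c).rootSet E) (τ : Equiv.Perm R)
      (_ : ∀ x, (e (τ x) : E) = σ (e x)), ∃ x₀, τ x₀ = x₀ ∧ (∀ x, x ≠ x₀ → τ x ≠ x) ∧
      ∀ x y, x ≠ x₀ → y ≠ x₀ → ∃ i : ℕ, (τ ^ i) x = y := by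
  set f := moriPoly g l p b c
  have : Fact p.Prime := ⟨h.prime_p⟩
  have hg := h.two_le
  have hll := h.l_le
  have hp2 := h.prime_p.two_le
  obtain ⟨Q, hQ, σ, hpQ, hσ⟩ := exists_frobenius E p
  -- The labelling `e` lets the conclusion be stated for the roots in `AlgebraicClosure ℚ`, while
  -- the arithmetic takes place in `E`.
  refine ⟨σ, fun {R} hcard e τ hτ => ?_⟩
  have : Finite R := Nat.finite_of_card_ne_zero (by omega)
  let := Ideal.Quotient.field Q
  let π := Ideal.Quotient.mk Q
  have hchar : CharP (NumberField.RingOfIntegers E ⧸ Q) p := by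
    refine (CharP.charP_iff_prime_eq_zero h.prime_p).mpr ?_
    rw [← map_natCast π]
    exact Ideal.Quotient.eq_zero_iff_mem.mpr hpQ
  have hroot : ∀ y : f.rootSet E, aeval (y : E) f = 0 :=
    fun y => (mem_rootSet.mp y.2).2
  let z : f.rootSet E → NumberField.RingOfIntegers E :=
    fun y => ⟨(l : E) * y, h.isIntegral_mul_root (hroot y)⟩
  have hz : ∀ y, z y ^ (2 * g) =
      ((b * l ^ (2 * g - 1) : ℤ) : NumberField.RingOfIntegers E) * z y +
        ((p * c * l ^ (2 * g - l) : ℤ) : NumberField.RingOfIntegers E) := by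
    intro y
    refine FaithfulSMul.algebraMap_injective _ E ?_
    rw [map_pow, map_add, map_mul, map_intCast, map_intCast]
    exact scaled_root_equation h.prime_l.ne_zero (by omega) (by omega) (hroot y)
  have hzinj : Function.Injective z := by
    intro y y' hyy
    refine Subtype.ext (mul_left_cancel₀ (a := (l : E)) ?_ ?_)
    · have := algebraRat.charZero E
      exact Nat.cast_ne_zero.mpr h.prime_l.ne_zero
    · exact congrArg (algebraMap _ E) hyy
  have hl : (l : NumberField.RingOfIntegers E ⧸ Q) ≠ 0 := by
    rw [Ne, CharP.cast_eq_zero_iff _ p]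
    exact fun hd => absurd (Nat.le_of_dvd h.prime_l.pos hd) (not_le.mpr h.l_lt_p)
  have hprim : IsPrimitiveRoot (b : NumberField.RingOfIntegers E ⧸ Q) (p - 1) := by
    have h1 := h.b_primitive.map_of_injective
      (ZMod.castHom dvd_rfl (NumberField.RingOfIntegers E ⧸ Q)).injective
    rwa [map_intCast] at h1
  have hb : (b : NumberField.RingOfIntegers E ⧸ Q) ≠ 0 :=
    hprim.ne_zero (by omega)
  have hζ : IsPrimitiveRoot
      ((b : NumberField.RingOfIntegers E ⧸ Q) ^ ((p - 1) / (2 * g - 1)))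
      (2 * g - 1) :=
    hprim.pow (by omega) (Nat.div_mul_cancel h.degree_dvd_p_sub_one).symm
  have ha : π ((b * l ^ (2 * g - 1) : ℤ) : NumberField.RingOfIntegers E) =
      b * l ^ (2 * g - 1) := by rw [map_intCast]; push_cast; rfl
  have ha0 := mul_ne_zero hb (pow_ne_zero (2 * g - 1) hl)
  have hd : π ((p * c * l ^ (2 * g - l) : ℤ) : NumberField.RingOfIntegers E) =
      0 := by
    rw [map_intCast]
    push_cast
    rw [CharP.cast_eq_zero, zero_mul, zero_mul]
  have hN1 : ((2 * g - 1 : ℕ) : NumberField.RingOfIntegers E ⧸ Q) ≠ 0 := by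
    rw [Ne, CharP.cast_eq_zero_iff _ p]
    intro hdvd
    have := Nat.le_of_dvd (by omega) hdvd
    have := Nat.le_of_dvd (by omega) h.degree_dvd_p_sub_one
    omega
  let r : R → NumberField.RingOfIntegers E ⧸ Q :=
    fun x => π (z (e x))
  have hr : Function.Injective r := by
    intro x y hxy
    by_contra hne
    refine reduction_ne_of_ne π (by omega) hd (ha ▸ ha0) hN1 (hz _) (hz _) ?_ hxy
    exact fun h1 => hne (e.injective (hzinj h1))
  have hrpow : ∀ x, r x ≠ 0 → r x ^ (2 * g - 1) = b * l ^ (2 * g - 1) := by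
    intro x hx
    refine mul_right_cancel₀ hx ?_
    rw [pow_sub_one_mul (by omega), ← ha]
    change π _ ^ _ = _ * π _
    rw [← map_pow, hz, map_add, hd, add_zero, map_mul]
  -- Frobenius sends `r` to `r ^ p = r ^ (p - 1) * r`, and for nonzero residues the factor `r ^ (p -
  -- 1)` is the same: it is `(b * l ^ (2g - 1)) ^ ((p - 1) / (2g - 1))`, where the contribution of
  -- `l` is `l ^ (p - 1) = 1`.
  have hperm : ∀ x, r (τ x) =
      (b : NumberField.RingOfIntegers E ⧸ Q) ^ ((p - 1) / (2 * g - 1)) * r x := by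
    intro x
    have h1 : r (τ x) = r x ^ p := by
      refine hσ _ _ ?_
      change (l : E) * e (τ x) = σ ((l : E) * e x)
      rw [map_mul, map_natCast, hτ]
    rw [h1]
    rcases eq_or_ne (r x) 0 with h0 | h0
    · rw [h0, zero_pow (by omega), mul_zero]
    · have h3 : r x ^ (p - 1) = (b : NumberField.RingOfIntegers E ⧸ Q) ^
          ((p - 1) / (2 * g - 1)) := by
        have hlp : (l : NumberField.RingOfIntegers E ⧸ Q) ^ (p - 1) = 1 := by
          have h4 := ZMod.pow_card_sub_one_eq_one (p := p) (a := (l : ZMod p)) (by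
            rw [Ne, CharP.cast_eq_zero_iff _ p]
            exact fun hd => absurd (Nat.le_of_dvd h.prime_l.pos hd) (not_le.mpr h.l_lt_p))
          have h5 := congrArg
            (ZMod.castHom dvd_rfl (NumberField.RingOfIntegers E ⧸ Q)) h4
          rwa [map_pow, map_natCast, map_one] at h5
        calc r x ^ (p - 1) = (r x ^ (2 * g - 1)) ^ ((p - 1) / (2 * g - 1)) := by
              rw [← pow_mul, Nat.mul_div_cancel' h.degree_dvd_p_sub_one]
          _ = _ := by
              rw [hrpow x h0, mul_pow, ← pow_mul, Nat.mul_div_cancel' h.degree_dvd_p_sub_one, hlp,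
                mul_one]
      rw [← h3, pow_sub_one_mul (by omega)]
  exact exists_fixed_point_of_mul_primitiveRoot (by omega) (by omega) hr ha0 hζ hrpow hperm

/-- The Galois group of `moriPoly`, as a permutation group of the roots, contains a permutation which
fixes one root and permutes the others cyclically. -/
theorem exists_mem_galPermGroup :
    ∃ σ ∈ galPermGroup (moriPoly g l p b c), ∃ x₀, σ x₀ = x₀ ∧ (∀ x, x ≠ x₀ → σ x ≠ x) ∧
      ∀ x y, x ≠ x₀ → y ≠ x₀ → ∃ i : ℕ, (σ ^ i) x = y := by
  set f := moriPoly g l p b c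
  have : Fact (f.map (algebraMap ℚ (AlgebraicClosure ℚ))).Splits := ⟨IsAlgClosed.splits _⟩
  let inst : Algebra ℚ f.SplittingField := SplittingField.instAlgebra_1 f
  have : IsGalois ℚ f.SplittingField := @IsGalois.of_separable_splitting_field ℚ _ _ _ inst f
    (IsSplittingField.splittingField f) h.irreducible_moriPoly.separable
  have : FiniteDimensional ℚ f.SplittingField := IsSplittingField.finiteDimensional _ f
  obtain ⟨σ, hσ⟩ := h.exists_frobenius_perm (E := f.SplittingField)
  refine ⟨_, ⟨σ, rfl⟩, hσ h.card_rootSet (Gal.rootsEquivRoots f (AlgebraicClosure ℚ)).symm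
    _ fun x => ?_⟩
  exact congrArg Subtype.val ((Gal.rootsEquivRoots f (AlgebraicClosure ℚ)).symm_apply_apply _)

end IsAdmissible

/-! ### Ramification and discriminants. -/

/-- A prime for which a root of `X ^ N - a X - d` satisfies an Eisenstein condition divides the
discriminant. -/
theorem dvd_discr_of_trinomial_eisenstein {K : Type*} [Field K] [NumberField K] {N q : ℕ}
    (hN : 2 ≤ N) (hq : q.Prime) {a m : ℤ} (ha : (q : ℤ) ∣ a) (hm : ¬ (q : ℤ) ∣ m)
    {β : NumberField.RingOfIntegers K} (hβ : β ^ N = a * β + ((q * m : ℤ) :)) :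
    (q : ℤ) ∣ NumberField.discr K := by
  have hqi := Nat.prime_iff_prime_int.mp hq
  by_contra hdvd
  rw [NumberField.not_dvd_discr_iff_forall_mem K (NumberField.RingOfIntegers K) hqi] at hdvd
  have hmax : (Ideal.span {(q : ℤ)}).IsMaximal :=
    PrincipalIdealRing.isMaximal_of_irreducible hqi.irreducible
  obtain ⟨P, hP, hPq⟩ := Ideal.exists_ideal_over_maximal_of_isIntegral
    (S := NumberField.RingOfIntegers K) (Ideal.span {(q : ℤ)}) (by
      rw [(RingHom.injective_iff_ker_eq_bot _).mp
        (FaithfulSMul.algebraMap_injective ℤ (NumberField.RingOfIntegers K))]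
      exact bot_le)
  have hmem : ((q : ℤ) : NumberField.RingOfIntegers K) ∈ P := by
    have : (q : ℤ) ∈ P.comap (algebraMap ℤ (NumberField.RingOfIntegers K)) := by
      rw [hPq]; exact Ideal.mem_span_singleton_self _
    simpa using this
  have hprime := hP.isPrime
  obtain ⟨a', rfl⟩ := ha
  have hβP : β ∈ P := by
    refine hprime.mem_of_pow_mem N ?_
    rw [hβ]
    push_cast at hmem ⊢
    exact add_mem (Ideal.mul_mem_right _ _ (Ideal.mul_mem_right _ _ hmem))
      (Ideal.mul_mem_right _ _ hmem)
  have hqm : ((q * m : ℤ) : NumberField.RingOfIntegers K) ∈ P ^ 2 := by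
    have h1 : ((q * m : ℤ) : NumberField.RingOfIntegers K) =
        β ^ N - (((q : ℤ) : NumberField.RingOfIntegers K) * β) * a' := by
      rw [hβ]; push_cast; ring
    rw [h1]
    refine sub_mem (Ideal.pow_le_pow_right hN (Ideal.pow_mem_pow hβP N))
      (Ideal.mul_mem_right _ _ ?_)
    rw [pow_two]
    exact Ideal.mul_mem_mul hmem hβP
  -- Both `q ^ 2` and `q * m` lie in `P ^ 2`, and `m` is prime to `q`.
  have hq2 : ((q : ℤ) : NumberField.RingOfIntegers K) ∈ P ^ 2 := by
    obtain ⟨u, v, huv⟩ := (hqi.coprime_iff_not_dvd).mpr hm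
    have h1 : ((q : ℤ) : NumberField.RingOfIntegers K) =
        u * (((q : ℤ) : NumberField.RingOfIntegers K) ^ 2) +
          v * ((q * m : ℤ) : NumberField.RingOfIntegers K) := by
      have h2 := congrArg (Int.cast : ℤ → NumberField.RingOfIntegers K) huv
      push_cast at h2 ⊢
      linear_combination (-(q : NumberField.RingOfIntegers K)) * h2
    rw [h1]
    exact add_mem (Ideal.mul_mem_left _ _ (Ideal.pow_mem_pow hmem 2)) (Ideal.mul_mem_left _ _ hqm)
  refine (dvd_differentIdeal_iff (A := ℤ) (P := P)).mp ?_ (hdvd P hprime hmem)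
  -- The exponent is `2 - 1`: since `P ^ 2` divides `q`, `P ^ (2 - 1)` divides the different,
  -- contradicting unramifiedness at `P`.
  rw [← pow_one P]
  refine pow_sub_one_dvd_differentIdeal ℤ (p := Ideal.span {(q : ℤ)}) P 2 ?_ ?_
  · rw [Ne, Ideal.span_singleton_eq_bot]
    exact hqi.ne_zero
  · rw [Ideal.dvd_iff_le, Ideal.map_span, Ideal.span_le, Set.image_singleton,
      Set.singleton_subset_iff]
    simpa using hq2

/-- A prime modulo which `X ^ N - a X - d` becomes the separable polynomial `X ^ N - a X` does not
divide the discriminant of the field generated by a root. -/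
theorem not_dvd_discr_of_trinomial_separable {K : Type*} [Field K] [NumberField K]
    [inst : Algebra ℚ K] {N q : ℕ} (hN : 2 ≤ N) (hq : q.Prime) {a d : ℤ} (ha : ¬ (q : ℤ) ∣ a)
    (hd : (q : ℤ) ∣ d) (hN1 : ¬ q ∣ N - 1) {β : NumberField.RingOfIntegers K}
    (hβ : β ^ N = a * β + d) (htop : Algebra.adjoin ℚ {(β : K)} = ⊤) :
    ¬ (q : ℤ) ∣ NumberField.discr K := by
  obtain rfl : inst = DivisionRing.toRatAlgebra := Subsingleton.elim _ _
  have hqi := Nat.prime_iff_prime_int.mp hq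
  rw [NumberField.not_dvd_discr_iff_forall_mem K (NumberField.RingOfIntegers K) hqi]
  intro P hP hmem
  rw [← not_dvd_differentIdeal_iff]
  intro hdiff
  have hmax : P.IsMaximal := hP.isMaximal (by
    rintro rfl
    exact hqi.ne_zero (by exact_mod_cast (Ideal.mem_bot.mp hmem)))
  let := Ideal.Quotient.field P
  have hchar : CharP (NumberField.RingOfIntegers K ⧸ P) q := by
    refine (CharP.charP_iff_prime_eq_zero hq).mpr ?_
    rw [← map_natCast (Ideal.Quotient.mk P)]
    exact Ideal.Quotient.eq_zero_iff_mem.mpr (by simpa using hmem)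
  let F : ℤ[X] := X ^ N - (C a * X + C d)
  have hF : aeval β F = 0 := by simp [F, hβ]
  -- `F` is only known to be a multiple of the minimal polynomial of `β`; by the product rule
  -- `F'(β)` is then a multiple of the derivative of that minimal polynomial at `β`, which lies in
  -- the different.
  have hder : aeval β (derivative F) ∈ differentIdeal ℤ (NumberField.RingOfIntegers K) := by
    obtain ⟨G, hG⟩ := minpoly.isIntegrallyClosed_dvd (Algebra.IsIntegral.isIntegral (R := ℤ) β) hF
    rw [hG, derivative_mul, map_add, map_mul, map_mul, minpoly.aeval, zero_mul, add_zero]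
    exact Ideal.mul_mem_right _ _ (aeval_derivative_mem_differentIdeal ℤ ℚ K β htop)
  have hderP := Ideal.Quotient.eq_zero_iff_mem.mpr (Ideal.dvd_iff_le.mp hdiff hder)
  have h1 := congrArg (Ideal.Quotient.mk P) hβ
  rw [map_pow, map_add, map_mul, map_intCast, map_intCast,
    (CharP.intCast_eq_zero_iff _ q d).mpr hd, add_zero] at h1
  refine not_multiple_root hN (a := (a : NumberField.RingOfIntegers K ⧸ P)) ?_ ?_ h1 ?_
  · rwa [Ne, CharP.intCast_eq_zero_iff _ q]
  · rwa [Ne, CharP.cast_eq_zero_iff _ q]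
  · simpa [F, sub_eq_zero, derivative_X_pow] using hderP

namespace IsAdmissible

variable {g l p : ℕ} {b c : ℤ} (h : IsAdmissible g l p b c)
include h

/-- The algebraic integer `l α`, for a root `α` of `moriPoly`. -/
theorem exists_integer_root {K : Type*} [Field K] [Algebra ℚ K] {x : K}
    (hx : aeval x (moriPoly g l p b c) = 0) :
    ∃ β : NumberField.RingOfIntegers K, (β : K) = l * x ∧
      β ^ (2 * g) = ((b * l ^ (2 * g - 1) : ℤ) : NumberField.RingOfIntegers K) * β +
        ((p * c * l ^ (2 * g - l) : ℤ) : NumberField.RingOfIntegers K) := by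
  have hg := h.two_le
  have hl := h.l_le
  obtain ⟨β, hβ⟩ : ∃ β : NumberField.RingOfIntegers K,
      algebraMap (NumberField.RingOfIntegers K) K β = l * x :=
    ⟨⟨(l : K) * x, h.isIntegral_mul_root hx⟩, rfl⟩
  refine ⟨β, hβ, FaithfulSMul.algebraMap_injective _ K ?_⟩
  rw [map_pow, map_add, map_mul, map_intCast, map_intCast, hβ]
  exact scaled_root_equation h.prime_l.ne_zero (by omega) (by omega) hx

/-- The congruence makes `q` divide `c` exactly once, and `q` divides neither `p` nor `l`, so the
equation of `l α` is Eisenstein at `q`. -/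
theorem dvd_discr {K : Type*} [Field K] [NumberField K] [algK : Algebra ℚ K] {x : K}
    (hx : aeval x (moriPoly g l p b c) = 0) {q : ℕ} (hq : q.Prime) (hqb : (q : ℤ) ∣ b)
    (hqn : ¬ q ∣ 2 * g * l * p) (hqc : c ≡ (q : ℤ) [ZMOD (q : ℤ) ^ 2]) :
    (q : ℤ) ∣ NumberField.discr K := by
  have hg := h.two_le
  have hqi := Nat.prime_iff_prime_int.mp hq
  obtain ⟨β, -, hβ⟩ := h.exists_integer_root hx
  obtain ⟨k, hk⟩ := hqc.symm.dvd
  have hc : c = q * (1 + q * k) := by linear_combination hk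
  refine dvd_discr_of_trinomial_eisenstein (N := 2 * g)
    (m := p * (1 + q * k) * l ^ (2 * g - l))
    (by omega) hq (hqb.mul_right _) (fun hd => ?_) (β := β) (a := b * l ^ (2 * g - 1)) ?_
  · rcases hqi.dvd_or_dvd hd with hd | hd
    · rcases hqi.dvd_or_dvd hd with hd | hd
      · exact hqn ((Int.natCast_dvd_natCast.mp hd).mul_left _)
      · have h1 := (Int.dvd_add_left (dvd_mul_right (q : ℤ) k)).mp hd
        exact hqi.not_dvd_one h1
    · exact hqn (((Int.natCast_dvd_natCast.mp (hqi.dvd_of_dvd_pow hd)).mul_left _).mul_right _)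
  · rw [hβ, hc]
    push_cast
    ring

/-- Since `l ∤ c`, the prime `q ∣ c` differs from `l`; hence passing to `l α` keeps the linear
coefficient prime to `q`. It also generates the same field. -/
theorem not_dvd_discr {K : Type*} [Field K] [NumberField K] [algK : Algebra ℚ K] {x : K}
    (hx : aeval x (moriPoly g l p b c) = 0) (htop : Algebra.adjoin ℚ {x} = ⊤)
    {q : ℕ} (hq : q.Prime) (hqc : (q : ℤ) ∣ c)
    (hqn : ¬ (q : ℤ) ∣ (2 * (g : ℤ) - 1) * p * b) :
    ¬ (q : ℤ) ∣ NumberField.discr K := by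
  have hg := h.two_le
  have hqi := Nat.prime_iff_prime_int.mp hq
  obtain ⟨β, hβx, hβ⟩ := h.exists_integer_root hx
  have hql : ¬ (q : ℤ) ∣ l := by
    intro hd
    rw [Int.natCast_dvd_natCast, Nat.prime_dvd_prime_iff_eq hq h.prime_l] at hd
    exact h.l_not_dvd_c (hd ▸ hqc)
  refine not_dvd_discr_of_trinomial_separable (by omega) hq (fun hd => ?_)
    ((hqc.mul_left _).mul_right _) (fun hd => hqn ?_) hβ ?_
  · rcases hqi.dvd_or_dvd hd with hd | hd
    · exact hqn (hd.mul_left _)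
    · exact hql (hqi.dvd_of_dvd_pow hd)
  · have h1 := Int.natCast_dvd_natCast.mpr hd
    push_cast [show 1 ≤ 2 * g by omega] at h1
    exact (h1.mul_right _).mul_right _
  · rw [eq_top_iff, ← htop]
    refine Algebra.adjoin_le (Set.singleton_subset_iff.mpr ?_)
    have hl : (l : K) ≠ 0 := Nat.cast_ne_zero.mpr h.prime_l.ne_zero
    have h2 : x = (l : ℚ)⁻¹ • (β : K) := by
      rw [hβx, Algebra.smul_def, map_inv₀, map_natCast, inv_mul_cancel_left₀ hl]
    rw [h2]
    exact Subalgebra.smul_mem _ (Algebra.self_mem_adjoin_singleton ℚ _) _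

end IsAdmissible

/-! ### Assembly of the six statements. -/

theorem lemma7p1 (g l p : ℕ) (b c : ℤ) [Fact l.Prime] [Fact p.Prime]
    (h : IsAdmissible g l p b c) :
    -- (i) irreducibility over the `l`-adic numbers and over the rationals
    (Irreducible ((moriPoly g l p b c).map (algebraMap ℚ ℚ_[l])) ∧
      Irreducible (moriPoly g l p b c)) ∧
    -- (ii) reduction along the unique ring homomorphism from `ℤ[1/l]` to `ZMod p`
    (∃ φ : ZInv l →+* ZMod p, (∀ ψ : ZInv l →+* ZMod p, ψ = φ) ∧
      (moriPolyZInv g l p b c).map φ = X * (X ^ (2 * g - 1) - C (b : ZMod p)) ∧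
      (X ^ (2 * g - 1) - C (b : ZMod p)).natDegree = 2 * g - 1 ∧
      Irreducible (X ^ (2 * g - 1) - C (b : ZMod p))) ∧
    -- (iii) the Galois group as a permutation group of the `2g` roots
    (Nat.card ((moriPoly g l p b c).rootSet (AlgebraicClosure ℚ)) = 2 * g ∧
      MulAction.IsPretransitive
        (galPermGroup (moriPoly g l p b c))
        ((moriPoly g l p b c).rootSet (AlgebraicClosure ℚ)) ∧
      (∃ σ ∈ (galPermGroup (moriPoly g l p b c)),
        σ.IsCycle ∧ {x | σ x ≠ x}.ncard = 2 * g - 1) ∧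
      MulAction.IsMultiplyPretransitive
        (galPermGroup (moriPoly g l p b c))
        ((moriPoly g l p b c).rootSet (AlgebraicClosure ℚ)) 2) ∧
    -- (iv) real roots
    ((¬ ∃ x : ℝ, aeval x (moriPoly g l p b c) = 0) ↔
      (c : ℝ) < (l : ℝ) ^ l * oddRoot (2 * g - 1) ((b : ℝ) / (2 * g)) *
        ((b : ℝ) / (2 * g) - b) / p) ∧
    -- (v), (vi) the discriminant of the number field `ℚ[x]/(f)`
    (∃ _ : Fact (Irreducible (moriPoly g l p b c)),
      ∃ _ : NumberField (AdjoinRoot (moriPoly g l p b c)),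
        (∀ q : ℕ, q.Prime → (q : ℤ) ∣ b → ¬ q ∣ 2 * g * l * p →
          c ≡ (q : ℤ) [ZMOD (q : ℤ) ^ 2] →
          (q : ℤ) ∣ NumberField.discr (AdjoinRoot (moriPoly g l p b c))) ∧
        (∀ q : ℕ, q.Prime → (q : ℤ) ∣ c → ¬ (q : ℤ) ∣ (2 * (g : ℤ) - 1) * p * b →
          ¬ (q : ℤ) ∣ NumberField.discr (AdjoinRoot (moriPoly g l p b c)))) := by
  have hfact : Fact (Irreducible (moriPoly g l p b c)) := ⟨h.irreducible_moriPoly⟩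
  obtain ⟨φ, hφ, hred⟩ := h.exists_reduction
  obtain ⟨σ, hσ, x₀, hfix, hmove, htrans⟩ := h.exists_mem_galPermGroup
  have hpre := h.galPermGroup_isPretransitive
  have hg := h.two_le
  have hcard : Nat.card ((moriPoly g l p b c).rootSet (AlgebraicClosure ℚ)) = 2 * g - 1 + 1 := by
    rw [h.card_rootSet]
    omega
  have : Finite ((moriPoly g l p b c).rootSet (AlgebraicClosure ℚ)) :=
    Nat.finite_of_card_ne_zero (by omega)
  have hroot := (AdjoinRoot.aeval_eq (f := moriPoly g l p b c) (moriPoly g l p b c)).trans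
    AdjoinRoot.mk_self
  exact ⟨⟨h.irreducible_map_padic, h.irreducible_moriPoly⟩,
    ⟨φ, hφ, hred, natDegree_X_pow_sub_C, h.irreducible_X_pow_sub_b⟩,
    ⟨h.card_rootSet, hpre,
      ⟨σ, hσ, isCycle_and_ncard_of_fixed_point (by omega) hcard hfix hmove htrans⟩,
      isMultiplyPretransitive_two_of_fixed_point hσ hfix htrans⟩,
    h.no_real_root_iff,
    ⟨hfact, inferInstance, fun q hq hqb hqn hqc => h.dvd_discr (algK := _) hroot hq hqb hqn hqc,
      fun q hq hqc hqn => h.not_dvd_discr (algK := _) hroot AdjoinRoot.adjoinRoot_eq_top hq hqc hqn⟩⟩
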